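/- All graphs are finite and simple. For a graph $G$, let $n(G)$ be its number of vertices, and let $n_o(G)$ and $n_e(G)$ be the numbers of vertices of odd and of even degree, respectively. A path decomposition of $G$ is a collection of pairwise edge-disjoint paths in $G$ that covers all the edges of $G$, and $p(G)$ is the minimum number of paths in a path decomposition of $G$. Let $P_m$ denote the path on $m$ vertices and let $\Box$ denote the Cartesian product of graphs. **Theorem 3.1.** For every integer $m \ge 2$ and every connected graph $H$, $$p(P_m\Box H)\;\le\;\frac{m\,n_o(H)}{2}+n_e(H)\qquad\text{and}\qquad p(P_m\Box H)\;\le\;\frac{n(P_m\Box H)}{2}.$$ -/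

import Mathlib

namespace GallaiPath

open SimpleGraph

/-- A subgraph of `G` is a path if it consists of the vertices and edges traversed by a walk
without repeated vertices. -/
def IsPathSubgraph {V : Type*} {G : SimpleGraph V} (P : G.Subgraph) : Prop :=
  ∃ (u v : V) (w : G.Walk u v), w.IsPath ∧ w.toSubgraph = P

/-- A path decomposition of `G`: a finite collection of pairwise edge-disjoint paths in `G`
that covers all the edges of `G`. -/
structure IsPathDecomposition {V : Type*} (G : SimpleGraph V) (D : Finset G.Subgraph) : Prop where
  isPath : ∀ P ∈ D, IsPathSubgraph P
  edgeDisjoint : ∀ P ∈ D, ∀ Q ∈ D, P ≠ Q → Disjoint P.edgeSet Q.edgeSet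
  cover : ∀ e ∈ G.edgeSet, ∃ P ∈ D, e ∈ P.edgeSet

/-- `p(G)`: the minimum number of paths in a path decomposition of `G`. For finite `G` the
minimum exists, see `exists_isPathDecomposition_card_eq`. -/
noncomputable def pathNumber {V : Type*} (G : SimpleGraph V) : ℕ :=
  sInf {k : ℕ | ∃ D : Finset G.Subgraph, IsPathDecomposition G D ∧ D.card = k}

/-- `n_o(G)`: the number of vertices of odd degree. -/
def numOdd {V : Type*} [Fintype V] (G : SimpleGraph V) [DecidableRel G.Adj] : ℕ :=
  (Finset.univ.filter fun v => Odd (G.degree v)).card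

/-- `n_e(G)`: the number of vertices of even degree. -/
def numEven {V : Type*} [Fintype V] (G : SimpleGraph V) [DecidableRel G.Adj] : ℕ :=
  (Finset.univ.filter fun v => Even (G.degree v)).card

/-- Every finite graph has a path decomposition: take every edge as a path. -/
theorem exists_isPathDecomposition {V : Type*} [Finite V] (G : SimpleGraph V) :
    ∃ D : Finset G.Subgraph, IsPathDecomposition G D := by
  classical
  have hfin : {P : G.Subgraph | ∃ (a b : V) (h : G.Adj a b), P = G.subgraphOfAdj h}.Finite :=
    Set.toFinite _
  refine ⟨hfin.toFinset, ?_, ?_, ?_⟩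
  · intro P hP
    obtain ⟨a, b, h, rfl⟩ := hfin.mem_toFinset.1 hP
    refine ⟨a, b, h.toWalk, ?_, ?_⟩
    · simp [Walk.cons_isPath_iff, h.ne]
    · simp
  · intro P hP Q hQ hne
    obtain ⟨a, b, h, rfl⟩ := hfin.mem_toFinset.1 hP
    obtain ⟨c, d, h', rfl⟩ := hfin.mem_toFinset.1 hQ
    rw [edgeSet_subgraphOfAdj, edgeSet_subgraphOfAdj, Set.disjoint_singleton]
    intro he
    apply hne
    rcases Sym2.eq_iff.1 he with ⟨rfl, rfl⟩ | ⟨rfl, rfl⟩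
    · rfl
    · exact (subgraphOfAdj_symm h).symm
  · intro e he
    induction e with
    | _ a b =>
      have h : G.Adj a b := he
      refine ⟨G.subgraphOfAdj h, hfin.mem_toFinset.2 ⟨a, b, h, rfl⟩, ?_⟩
      rw [edgeSet_subgraphOfAdj]
      exact Set.mem_singleton _

/-- For a finite graph the minimum in the definition of `pathNumber` is attained. -/
theorem exists_isPathDecomposition_card_eq {V : Type*} [Finite V] (G : SimpleGraph V) :
    ∃ D : Finset G.Subgraph, IsPathDecomposition G D ∧ D.card = pathNumber G := by
  obtain ⟨D, hD⟩ := exists_isPathDecomposition G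
  exact Nat.sInf_mem (s := {k : ℕ | ∃ D : Finset G.Subgraph, IsPathDecomposition G D ∧ D.card = k})
    ⟨_, D, hD, rfl⟩

/-- Any path decomposition bounds `pathNumber` from above. -/
theorem pathNumber_le_card {V : Type*} {G : SimpleGraph V} {D : Finset G.Subgraph}
    (hD : IsPathDecomposition G D) : pathNumber G ≤ D.card :=
  Nat.sInf_le ⟨D, hD, rfl⟩

end GallaiPath

/-!
Lovász's switching argument gives a path decomposition of `H`, with one-vertex paths allowed, in
which every vertex is an end once if its degree is odd and twice if its degree is even. Orient the
paths so that their starts are distinct and their finishes are distinct, and take a copy of them in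
every layer of `P_m □ H`. Adding all edges between consecutive layers, every copy that finishes at
`v` is continued by the edge over `v` and the path, if any, that starts at `v` in the next layer.
New paths begin between two layers only at the vertices where no path finishes; there are
`n_o(H) / 2` of those, and the decomposition of `H` has `n_o(H) / 2 + n_e(H)` paths.
-/

namespace GallaiPath

open SimpleGraph

/-- A path of `G` together with a direction of traversal, bundled with its endpoints; a path with a
single vertex is allowed. -/
structure OrientedPath {V : Type*} (G : SimpleGraph V) where
  start : V
  finish : V
  walk : G.Walk start finish
  isPath : walk.IsPath

namespace OrientedPath

variable {V W : Type*} {G : SimpleGraph V} {G' : SimpleGraph W}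

/-- The vertices of an oriented path, in order. -/
def support (p : OrientedPath G) : List V := p.walk.support

/-- The edges of an oriented path, each listed in the direction of traversal. -/
def darts (p : OrientedPath G) : List G.Dart := p.walk.darts

/-- The edges of an oriented path; a multiset, so that edges add up over families of paths. -/
def edges (p : OrientedPath G) : Multiset (Sym2 V) := p.walk.edges

/-- The one-vertex path at `v`. -/
@[simps start finish]
def single (G : SimpleGraph V) (v : V) : OrientedPath G := ⟨v, v, .nil, .nil⟩

/-- The same path traversed backwards. -/
@[simps start finish]
def reverse (p : OrientedPath G) : OrientedPath G := ⟨_, _, p.walk.reverse, p.isPath.reverse⟩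

/-- The path that traverses `p`, then an edge, then `q`. -/
@[simps start finish]
def join (p q : OrientedPath G) (h : G.Adj p.finish q.start)
    (hd : p.support.Disjoint q.support) : OrientedPath G where
  start := p.start
  finish := q.finish
  walk := p.walk.append (.cons h q.walk)
  isPath := by
    rw [Walk.isPath_def, Walk.support_append, Walk.support_cons, List.tail_cons]
    exact p.isPath.support_nodup.append q.isPath.support_nodup hd

/-- The image of an oriented path under an embedding of graphs. -/
def map (f : G ↪g G') (p : OrientedPath G) : OrientedPath G' :=
  ⟨_, _, p.walk.map f.toHom, p.isPath.map f.injective⟩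

@[simp] lemma support_single (v : V) : (single G v).support = [v] := rfl

@[simp] lemma edges_single (v : V) : (single G v).edges = 0 := rfl

@[simp] lemma support_reverse (p : OrientedPath G) : p.reverse.support = p.support.reverse :=
  p.walk.support_reverse

@[simp] lemma edges_reverse (p : OrientedPath G) : p.reverse.edges = p.edges := by
  rw [edges, reverse, Walk.edges_reverse]
  exact Multiset.coe_reverse _

@[simp] lemma reverse_reverse (p : OrientedPath G) : p.reverse.reverse = p := by
  simp [reverse]

lemma mem_darts_reverse {p : OrientedPath G} {d : G.Dart} :
    d ∈ p.reverse.darts ↔ d.symm ∈ p.darts :=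
  Walk.mem_darts_reverse

section Join

variable (p q : OrientedPath G) (h : G.Adj p.finish q.start) (hd : p.support.Disjoint q.support)

lemma support_join : (p.join q h hd).support = p.support ++ q.support := by
  simp [join, support, Walk.support_append]

lemma darts_join : (p.join q h hd).darts = p.darts ++ ⟨(p.finish, q.start), h⟩ :: q.darts := by
  simp [join, darts, Walk.darts_append]

lemma edges_join :
    (p.join q h hd).edges = s(p.finish, q.start) ::ₘ (p.edges + q.edges) := by
  rw [edges, join, Walk.edges_append, Walk.edges_cons, ← Multiset.coe_add, ← Multiset.cons_coe,
    Multiset.add_cons]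
  rfl

end Join

@[simp] protected lemma support_map (f : G ↪g G') (p : OrientedPath G) :
    (p.map f).support = p.support.map f :=
  p.walk.support_map _

@[simp] protected lemma edges_map (f : G ↪g G') (p : OrientedPath G) :
    (p.map f).edges = p.edges.map (Sym2.map f) := by
  rw [edges, map, Walk.edges_map]
  rfl

lemma start_mem_support (p : OrientedPath G) : p.start ∈ p.support := p.walk.start_mem_support

lemma edge_mem_edges {p : OrientedPath G} {d : G.Dart} (hd : d ∈ p.darts) : d.edge ∈ p.edges :=
  List.mem_map_of_mem hd

lemma snd_mem_support {p : OrientedPath G} {d : G.Dart} (hd : d ∈ p.darts) : d.snd ∈ p.support :=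
  p.walk.dart_snd_mem_support_of_mem_darts hd

lemma exists_eq_join {p : OrientedPath G} {a : V} (ha : a ∈ p.support) (hne : a ≠ p.start) :
    ∃ q r h hd, p = join q r h hd ∧ r.start = a := by
  obtain ⟨s, t, w, hw⟩ := p
  change a ∈ w.support at ha
  obtain ⟨w₁, w₂, rfl⟩ := Walk.mem_support_iff_exists_append.1 ha
  cases w₁ using Walk.concatRec with
  | Hnil => exact absurd rfl hne
  | Hconcat w₀ hadj =>
    have hnd := hw.support_nodup
    rw [Walk.concat_append] at hw hnd
    rw [Walk.support_append, Walk.support_cons, List.tail_cons] at hnd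
    refine ⟨⟨_, _, w₀, hw.of_append_left⟩, ⟨_, _, w₂, hw.of_append_right.of_cons⟩, hadj,
      (List.nodup_append'.1 hnd).2.2, ?_, rfl⟩
    simp [join, Walk.concat_append]

lemma eq_single_of_forall_notMem {p : OrientedPath G} (h : ∀ e ∈ p.edges, p.start ∉ e) :
    p = single G p.start := by
  obtain ⟨s, t, w, hw⟩ := p
  cases w with
  | nil => rfl
  | cons hadj w => exact absurd (Sym2.mem_mk_left _ _) (h _ List.mem_cons_self)

end OrientedPath

section Families

variable {V : Type*} {G : SimpleGraph V}

open OrientedPath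

/-- All edges traversed by a family of paths, with multiplicity. -/
def edgesOf (D : Multiset (OrientedPath G)) : Multiset (Sym2 V) := D.bind edges

/-- The paths of a family, each taken in both directions. -/
def legs (D : Multiset (OrientedPath G)) : Multiset (OrientedPath G) := D + D.map reverse

/-- The end vertices of the paths of a family, with multiplicity; a one-vertex path ends twice at
its vertex. -/
def endsOf (D : Multiset (OrientedPath G)) : Multiset V := (legs D).map start

@[simp] lemma edgesOf_zero : edgesOf (0 : Multiset (OrientedPath G)) = 0 := rfl

@[simp] lemma edgesOf_cons (p : OrientedPath G) (D : Multiset (OrientedPath G)) :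
    edgesOf (p ::ₘ D) = p.edges + edgesOf D :=
  Multiset.cons_bind _ _ _

@[simp] lemma edgesOf_add (D₁ D₂ : Multiset (OrientedPath G)) :
    edgesOf (D₁ + D₂) = edgesOf D₁ + edgesOf D₂ :=
  Multiset.add_bind _ _ _

lemma legs_cons (p : OrientedPath G) (D : Multiset (OrientedPath G)) :
    legs (p ::ₘ D) = p ::ₘ p.reverse ::ₘ legs D := by
  simp [legs, Multiset.cons_swap]

lemma mem_legs_cons {p q : OrientedPath G} {D : Multiset (OrientedPath G)} :
    q ∈ legs (p ::ₘ D) ↔ q = p ∨ q = p.reverse ∨ q ∈ legs D := by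
  simp [legs_cons]

@[simp] lemma endsOf_cons (p : OrientedPath G) (D : Multiset (OrientedPath G)) :
    endsOf (p ::ₘ D) = p.start ::ₘ p.finish ::ₘ endsOf D := by
  simp [endsOf, legs_cons]

lemma mem_endsOf {D : Multiset (OrientedPath G)} {v : V} :
    v ∈ endsOf D ↔ ∃ p ∈ legs D, p.start = v :=
  Multiset.mem_map

lemma exists_cons_of_mem_legs {p : OrientedPath G} {D : Multiset (OrientedPath G)}
    (hp : p ∈ legs D) : ∃ D₀, legs (p ::ₘ D₀) = legs D ∧ edgesOf (p ::ₘ D₀) = edgesOf D := by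
  rcases Multiset.mem_add.1 hp with hp | hp
  · obtain ⟨D₀, rfl⟩ := Multiset.exists_cons_of_mem hp
    exact ⟨D₀, rfl, rfl⟩
  · obtain ⟨q, hq, rfl⟩ := Multiset.mem_map.1 hp
    obtain ⟨D₀, rfl⟩ := Multiset.exists_cons_of_mem hq
    refine ⟨D₀, ?_, by simp⟩
    rw [legs_cons, legs_cons, reverse_reverse, Multiset.cons_swap]

lemma edge_mem_edgesOf {p : OrientedPath G} {D : Multiset (OrientedPath G)} {d : G.Dart}
    (hp : p ∈ legs D) (hd : d ∈ p.darts) : d.edge ∈ edgesOf D := by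
  obtain ⟨D₀, -, hE⟩ := exists_cons_of_mem_legs hp
  rw [← hE, edgesOf_cons]
  exact Multiset.mem_add.2 (.inl (edge_mem_edges hd))

/-- Every vertex of `S` is an end of a path that, followed from that end, either avoids `a` or
enters `a` from a vertex of `S`. Such a set confines the search for a path with a free end in
`exists_edgesOf_eq_cons_of_isSwitchClosed`. -/
def IsSwitchClosed (D : Multiset (OrientedPath G)) (a : V) (S : Finset V) : Prop :=
  ∀ c ∈ S, ∃ p ∈ legs D, p.start = c ∧ ∀ d ∈ p.darts, d.snd = a → d.fst ∈ S

lemma IsSwitchClosed.switch [DecidableEq V] {q r : OrientedPath G} {h : G.Adj q.finish r.start}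
    {hd : q.support.Disjoint r.support} {D : Multiset (OrientedPath G)} {S : Finset V}
    (hS : IsSwitchClosed (q.join r h hd ::ₘ D) r.start S)
    (hnew : s(q.start, r.start) ∉ edgesOf (q.join r h hd ::ₘ D))
    (h' : G.Adj q.reverse.finish r.start) (hd' : q.reverse.support.Disjoint r.support) :
    IsSwitchClosed (q.reverse.join r h' hd' ::ₘ D) r.start (S.erase q.start) := by
  intro c hc
  obtain ⟨hne, hcS⟩ := Finset.mem_erase.1 hc
  obtain ⟨p, hp, rfl, hpS⟩ := hS c hcS
  have hpS' : ∀ d ∈ p.darts, d.snd = r.start → d.fst ∈ S.erase q.start := by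
    refine fun d hdp hda => Finset.mem_erase.2 ⟨fun hdb => hnew ?_, hpS d hdp hda⟩
    rw [← hdb, ← hda]
    exact edge_mem_edgesOf hp hdp
  rcases mem_legs_cons.1 hp with rfl | rfl | hpD
  · exact absurd rfl hne
  · refine ⟨_, mem_legs_cons.2 (.inr (.inl rfl)), rfl, fun d hdp hda => hpS' d ?_ hda⟩
    rw [mem_darts_reverse, darts_join] at hdp ⊢
    have hfst : d.symm.fst = r.start := hda
    rcases List.mem_append.1 hdp with hdq | hdr
    · refine absurd r.start_mem_support (hd ?_)
      rw [← hda]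
      exact snd_mem_support (mem_darts_reverse.1 hdq)
    · rcases List.mem_cons.1 hdr with hdr | hdr
      · rw [hdr] at hfst
        exact absurd hfst h'.ne
      · exact List.mem_append_right _ (List.mem_cons_of_mem _ hdr)
  · exact ⟨p, mem_legs_cons.2 (.inr (.inr hpD)), rfl, hpS'⟩

lemma exists_edgesOf_eq_cons_of_isSwitchClosed {D : Multiset (OrientedPath G)} {a b : V}
    {S : Finset V} (hS : IsSwitchClosed D a S) (ha : a ∉ S) (hb : b ∈ S) (hba : G.Adj b a)
    (hnew : (s(b, a) ::ₘ edgesOf D).Nodup) :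
    ∃ D' : Multiset (OrientedPath G),
      edgesOf D' = s(b, a) ::ₘ edgesOf D ∧ b ::ₘ endsOf D' = a ::ₘ endsOf D := by
  classical
  induction S using Finset.strongInduction generalizing D b with
  | H S ih =>
    obtain ⟨p, hp, rfl, hpS⟩ := hS b hb
    obtain ⟨D₀, hL, hE⟩ := exists_cons_of_mem_legs hp
    rw [endsOf, ← hL, ← hE, ← endsOf]
    rw [← hE] at hnew
    rw [IsSwitchClosed, ← hL, ← IsSwitchClosed] at hS
    by_cases hap : a ∈ p.support
    · -- `p` enters `a` by an edge `s(x, a)`; exchanging it for the new edge leaves a path and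
      -- moves its end from `b` to `x`, so that `s(x, a)` is now the edge to be inserted.
      obtain ⟨q, r, hx, hd, rfl, rfl⟩ := exists_eq_join hap (ne_of_mem_of_not_mem hb ha).symm
      have hadj : G.Adj q.reverse.finish r.start := hba
      have hd' : q.reverse.support.Disjoint r.support := by simpa using hd
      set D₁ := q.reverse.join r hadj hd' ::ₘ D₀ with hD₁
      have hE₁ : s(q.finish, r.start) ::ₘ edgesOf D₁ =
          s(q.start, r.start) ::ₘ edgesOf (q.join r hx hd ::ₘ D₀) := by
        simp [hD₁, edges_join, Multiset.cons_swap]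
      have hmem : s(q.finish, r.start) ∈ edgesOf (q.join r hx hd ::ₘ D₀) := by
        simp [edges_join]
      have hne : q.finish ≠ q.start := by
        intro he
        rw [he] at hmem
        exact (Multiset.nodup_cons.1 hnew).1 hmem
      have hxS : q.finish ∈ S := hpS ⟨(q.finish, r.start), hx⟩ (by simp [darts_join]) rfl
      obtain ⟨D', hE', hends⟩ := ih (S.erase q.start) (Finset.erase_ssubset hb)
        (hS.switch (Multiset.nodup_cons.1 hnew).1 hadj hd') (by simp [ha])
        (Finset.mem_erase.2 ⟨hne, hxS⟩) hx (by rwa [hE₁])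
      refine ⟨D', hE'.trans hE₁, (Multiset.cons_inj_right q.finish).1 ?_⟩
      rw [Multiset.cons_swap, hends]
      simp [Multiset.cons_swap]
    · have hadj : G.Adj p.reverse.finish (single G a).start := hba
      refine ⟨p.reverse.join (single G a) hadj (by simpa using hap) ::ₘ D₀, ?_, ?_⟩
      · simp [edges_join]
      · simp [Multiset.cons_swap]

lemma exists_edgesOf_eq_cons [Finite V] {D : Multiset (OrientedPath G)} {a b : V}
    (hba : G.Adj b a) (hnew : (s(b, a) ::ₘ edgesOf D).Nodup)
    (hends : ∀ c ≠ a, s(c, a) ∈ s(b, a) ::ₘ edgesOf D → c ∈ endsOf D) :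
    ∃ D' : Multiset (OrientedPath G),
      edgesOf D' = s(b, a) ::ₘ edgesOf D ∧ b ::ₘ endsOf D' = a ::ₘ endsOf D := by
  classical
  cases nonempty_fintype V
  let S : Finset V := {c | c ≠ a ∧ s(c, a) ∈ s(b, a) ::ₘ edgesOf D}
  refine exists_edgesOf_eq_cons_of_isSwitchClosed (S := S) (fun c hc => ?_) (by simp [S])
    (by simp [S, hba.ne]) hba hnew
  obtain ⟨-, hca, hc⟩ := Finset.mem_filter.1 hc
  obtain ⟨p, hp, hpc⟩ := mem_endsOf.1 (hends c hca hc)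
  refine ⟨p, hp, hpc, fun d hd hda => ?_⟩
  subst hda
  exact Finset.mem_filter.2
    ⟨Finset.mem_univ _, d.adj.ne, Multiset.mem_cons_of_mem (edge_mem_edgesOf hp hd)⟩

end Families

section Balanced

variable {V : Type*} [DecidableEq V] {G : SimpleGraph V}

open OrientedPath

/-- The degree of `v` in the graph with edge set `E`. -/
def degreeIn (E : Finset (Sym2 V)) (v : V) : ℕ := (E.filter (v ∈ ·)).card

lemma degreeIn_insert {E : Finset (Sym2 V)} {e : Sym2 V} (he : e ∉ E) (v : V) :
    degreeIn (insert e E) v = degreeIn E v + if v ∈ e then 1 else 0 := by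
  by_cases hv : v ∈ e <;> simp [degreeIn, Finset.filter_insert, hv, he]

lemma degreeIn_edgeFinset [Fintype V] (G : SimpleGraph V) [DecidableRel G.Adj] (v : V) :
    degreeIn G.edgeFinset v = G.degree v := by
  rw [degreeIn, ← incidenceFinset_eq_filter, card_incidenceFinset_eq_degree]

/-- The family `D` decomposes the edge set `E`, and every vertex is an end exactly once if its
degree is odd and exactly twice if its degree is even. -/
structure IsBalanced (D : Multiset (OrientedPath G)) (E : Finset (Sym2 V)) : Prop where
  edgesOf_eq : edgesOf D = E.val
  count_endsOf (v : V) : (endsOf D).count v + degreeIn E v % 2 = 2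

/-- The family `D` is balanced except that `a` is not an end at all if its degree is even, so that
one more edge at `a` can be added. -/
structure IsBalancedExcept (D : Multiset (OrientedPath G)) (E : Finset (Sym2 V)) (a : V) :
    Prop where
  edgesOf_eq : edgesOf D = E.val
  count_endsOf_self : (endsOf D).count a = degreeIn E a % 2
  count_endsOf {v : V} (hv : v ≠ a) : (endsOf D).count v + degreeIn E v % 2 = 2

lemma IsBalancedExcept.exists_insert [Finite V] {D : Multiset (OrientedPath G)}
    {E : Finset (Sym2 V)} {a c : V} (hD : IsBalancedExcept D E c) (hac : G.Adj a c)
    (hnew : s(a, c) ∉ E) :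
    ∃ D' : Multiset (OrientedPath G), IsBalancedExcept D' (insert s(a, c) E) a := by
  have hE : s(a, c) ::ₘ edgesOf D = (insert s(a, c) E).val := by
    rw [hD.edgesOf_eq, Finset.insert_val_of_notMem hnew]
  have hends : ∀ x ≠ c, s(x, c) ∈ s(a, c) ::ₘ edgesOf D → x ∈ endsOf D := by
    intro x hxc _
    have := hD.count_endsOf hxc
    rw [← Multiset.one_le_count_iff_mem]
    omega
  obtain ⟨D', hE', hends'⟩ := exists_edgesOf_eq_cons hac (hE ▸ Finset.nodup _) hends
  have hcount (v : V) := congrArg (Multiset.count v) hends'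
  simp only [Multiset.count_cons] at hcount
  refine ⟨D', hE'.trans hE, ?_, fun {v} hva => ?_⟩
  · have hold := hD.count_endsOf hac.ne
    have hself := hcount a
    simp only [degreeIn_insert hnew, Sym2.mem_mk_left, if_true, if_neg hac.ne] at hself ⊢
    omega
  · have hv := hcount v
    rcases eq_or_ne v c with rfl | hvc
    · have hold := hD.count_endsOf_self
      simp only [degreeIn_insert hnew, Sym2.mem_mk_right, if_true, if_neg hva] at hv ⊢
      omega
    · have hold := hD.count_endsOf hvc
      simp only [degreeIn_insert hnew, Sym2.mem_iff, hva, hvc, or_self, if_false] at hv ⊢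
      omega

lemma IsBalancedExcept.exists_isBalanced {D : Multiset (OrientedPath G)} {E : Finset (Sym2 V)}
    {a : V} (hD : IsBalancedExcept D E a) :
    ∃ D' : Multiset (OrientedPath G), IsBalanced D' E := by
  have hself := hD.count_endsOf_self
  rcases Nat.mod_two_eq_zero_or_one (degreeIn E a) with ha | ha
  · refine ⟨single G a ::ₘ D, by simp [hD.edgesOf_eq], fun v => ?_⟩
    rcases eq_or_ne v a with rfl | hva
    · simp [hself, ha]
    · simpa [Multiset.count_cons_of_ne hva] using hD.count_endsOf hva
  · refine ⟨D, hD.edgesOf_eq, fun v => ?_⟩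
    rcases eq_or_ne v a with rfl | hva
    · omega
    · exact hD.count_endsOf hva

lemma IsBalanced.exists_isBalancedExcept {D : Multiset (OrientedPath G)} {E : Finset (Sym2 V)}
    (hD : IsBalanced D E) {a : V} (ha : ∀ e ∈ E, a ∉ e) :
    ∃ D' : Multiset (OrientedPath G), IsBalancedExcept D' E a := by
  have hdeg : degreeIn E a = 0 := by
    rwa [degreeIn, Finset.card_eq_zero, Finset.filter_eq_empty_iff]
  have hcount := hD.count_endsOf a
  obtain ⟨p, hp, rfl⟩ := mem_endsOf.1 (Multiset.count_pos.1 (by omega : 0 < (endsOf D).count a))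
  obtain ⟨D₀, hL, hE⟩ := exists_cons_of_mem_legs hp
  have hpE : p.edges + edgesOf D₀ = E.val := by rw [← edgesOf_cons, hE, hD.edgesOf_eq]
  have hps : p = single G p.start := by
    refine eq_single_of_forall_notMem fun e he => ha e ?_
    rw [← Finset.mem_val, ← hpE]
    exact Multiset.mem_add.2 (.inl he)
  generalize p.start = a at *
  subst hps
  have hends : endsOf D = a ::ₘ a ::ₘ endsOf D₀ := by
    rw [endsOf, ← hL, ← endsOf, endsOf_cons, single_start, single_finish]
  refine ⟨D₀, by simpa using hpE, ?_, fun {v} hva => ?_⟩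
  · simp only [hends, Multiset.count_cons_self, hdeg] at hcount ⊢
    omega
  · have hold := hD.count_endsOf v
    rwa [hends, Multiset.count_cons_of_ne hva, Multiset.count_cons_of_ne hva] at hold

lemma exists_isBalanced_of_forall [Finite V] {E : Finset (Sym2 V)}
    (hE : ∀ x y, s(x, y) ∈ E → ∃ D : Multiset (OrientedPath G), IsBalancedExcept D E x) :
    ∃ D : Multiset (OrientedPath G), IsBalanced D E := by
  rcases E.eq_empty_or_nonempty with rfl | ⟨e, he⟩
  · cases nonempty_fintype V
    refine ⟨Finset.univ.val.map (single G), ?_, fun v => ?_⟩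
    · simp [edgesOf, Multiset.bind_map]
    · have hends : endsOf (Finset.univ.val.map (single G)) = Finset.univ.val + Finset.univ.val := by
        simp [endsOf, legs]
      simp [hends, degreeIn]
  · induction e with
    | _ x y =>
      obtain ⟨D, hD⟩ := hE x y he
      exact hD.exists_isBalanced

lemma exists_isBalancedExcept [Finite V] {E : Finset (Sym2 V)} (hE : ∀ e ∈ E, e ∈ G.edgeSet)
    (a : V) : ∃ D : Multiset (OrientedPath G), IsBalancedExcept D E a := by
  induction E using Finset.strongInduction generalizing a with
  | H E ih =>
    have hmem (x y : V) (he : s(x, y) ∈ E) :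
        ∃ D : Multiset (OrientedPath G), IsBalancedExcept D E x := by
      obtain ⟨D, hD⟩ := ih (E.erase s(x, y)) (Finset.erase_ssubset he)
        (fun e he' => hE e (Finset.mem_of_mem_erase he')) y
      simpa only [Finset.insert_erase he] using hD.exists_insert (hE _ he) (Finset.notMem_erase _ _)
    by_cases ha : ∃ c, s(a, c) ∈ E
    · obtain ⟨c, hc⟩ := ha
      exact hmem a c hc
    · obtain ⟨D, hD⟩ := exists_isBalanced_of_forall hmem
      refine hD.exists_isBalancedExcept fun e he hae => ha ?_
      obtain ⟨c, rfl⟩ := hae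
      exact ⟨c, he⟩

theorem exists_isBalanced [Fintype V] (G : SimpleGraph V) [DecidableRel G.Adj] :
    ∃ D : Multiset (OrientedPath G), IsBalanced D G.edgeFinset :=
  exists_isBalanced_of_forall fun x _ _ =>
    exists_isBalancedExcept (fun _ he => mem_edgeFinset.1 he) x

end Balanced

section Orientation

variable {α : Type*}

/-- The pairs `t` direct the edges `s` of a multigraph so that no vertex is the source of two edges
or the target of two edges. -/
structure IsInjectiveOrientation (t : Multiset (α × α)) (s : Multiset (Sym2 α)) : Prop where
  map_mk : t.map (fun x => s(x.1, x.2)) = s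
  nodup_fst : (t.map Prod.fst).Nodup
  nodup_snd : (t.map Prod.snd).Nodup

lemma bind_toMultiset_map_mk (t : Multiset (α × α)) :
    (t.map fun x => s(x.1, x.2)).bind Sym2.toMultiset = t.map Prod.fst + t.map Prod.snd := by
  rw [Multiset.bind_map, ← Multiset.bind_singleton, ← Multiset.bind_singleton,
    ← Multiset.bind_add]
  rfl

lemma IsInjectiveOrientation.cons {t : Multiset (α × α)} {s : Multiset (Sym2 α)} {x y : α}
    (h : IsInjectiveOrientation t s) (hx : x ∉ s.bind Sym2.toMultiset)
    (hy : y ∉ s.bind Sym2.toMultiset) :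
    IsInjectiveOrientation ((x, y) ::ₘ t) (s(x, y) ::ₘ s) := by
  rw [← h.map_mk, bind_toMultiset_map_mk, Multiset.mem_add, not_or] at hx hy
  refine ⟨by rw [Multiset.map_cons, h.map_mk], ?_, ?_⟩
  · rw [Multiset.map_cons]
    exact h.nodup_fst.cons hx.1
  · rw [Multiset.map_cons]
    exact h.nodup_snd.cons hy.2

lemma IsInjectiveOrientation.subdivide {t : Multiset (α × α)} {s : Multiset (Sym2 α)} {x y v : α}
    (h : IsInjectiveOrientation t (s(x, y) ::ₘ s)) (hv : v ∉ (s(x, y) ::ₘ s).bind Sym2.toMultiset) :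
    ∃ t', IsInjectiveOrientation t' (s(x, v) ::ₘ s(v, y) ::ₘ s) := by
  obtain ⟨⟨p, q⟩, hpq, hxy⟩ :=
    Multiset.mem_map.1 (h.map_mk ▸ Multiset.mem_cons_self s(x, y) _)
  obtain ⟨t, rfl⟩ := Multiset.exists_cons_of_mem hpq
  obtain ⟨hs, hfst, hsnd⟩ := h
  rw [← hs, bind_toMultiset_map_mk] at hv
  simp only [Multiset.map_cons, Multiset.mem_add, Multiset.mem_cons, not_or] at hv
  rw [Multiset.map_cons, hxy, Multiset.cons_inj_right] at hs
  rw [Multiset.map_cons, Multiset.nodup_cons] at hfst hsnd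
  refine ⟨(p, v) ::ₘ (v, q) ::ₘ t, ?_, ?_, ?_⟩
  · rcases Sym2.eq_iff.1 hxy with ⟨rfl, rfl⟩ | ⟨rfl, rfl⟩
    · simp [hs]
    · simp [hs, Multiset.cons_swap, Sym2.eq_swap]
  · simp [hfst, hv, Ne.symm hv.1.1]
  · simp [hsnd, hv]

lemma count_bind_toMultiset_cons [DecidableEq α] (x y v : α) (s : Multiset (Sym2 α)) :
    ((s(x, y) ::ₘ s).bind Sym2.toMultiset).count v =
      (if v = x then 1 else 0) + (if v = y then 1 else 0) + (s.bind Sym2.toMultiset).count v := by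
  have hmk : s(x, y).toMultiset = {x} + {y} := rfl
  rw [Multiset.cons_bind, hmk, Multiset.count_add, Multiset.count_add, Multiset.count_singleton,
    Multiset.count_singleton]

lemma exists_isInjectiveOrientation [DecidableEq α] {s : Multiset (Sym2 α)}
    (hs : ∀ v, (s.bind Sym2.toMultiset).count v ≤ 2) : ∃ t, IsInjectiveOrientation t s := by
  induction hn : s.card generalizing s with
  | zero =>
    obtain rfl := Multiset.card_eq_zero.1 hn
    exact ⟨0, by simp, by simp, by simp⟩
  | succ n ih =>
    obtain ⟨e, s, rfl, hcard⟩ := Multiset.card_eq_succ_iff.1 hn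
    by_cases hshare : ∃ v ∈ e, v ∈ s.bind Sym2.toMultiset
    · -- Two edges that meet at `v` are merged; no other edge contains `v`.
      obtain ⟨v, ⟨x, rfl⟩, hv⟩ := hshare
      obtain ⟨f, hf, hvf⟩ := Multiset.mem_bind.1 hv
      obtain ⟨y, rfl⟩ := Sym2.mem_toMultiset.1 hvf
      obtain ⟨s, rfl⟩ := Multiset.exists_cons_of_mem hf
      simp only [count_bind_toMultiset_cons] at hs
      obtain ⟨t, ht⟩ := ih (s := s(x, y) ::ₘ s)
        (fun u => by
          have := hs u
          rw [count_bind_toMultiset_cons]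
          omega)
        (by simpa using hcard)
      rw [Sym2.eq_swap (a := v) (b := x)]
      refine ht.subdivide (Multiset.count_eq_zero.1 ?_)
      have := hs v
      rw [if_pos rfl] at this
      rw [count_bind_toMultiset_cons]
      omega
    · push Not at hshare
      have hle : s.bind Sym2.toMultiset ≤ (e ::ₘ s).bind Sym2.toMultiset := by
        rw [Multiset.cons_bind]
        exact Multiset.le_add_left _ _
      obtain ⟨t, ht⟩ := ih (fun v => (Multiset.count_le_of_le v hle).trans (hs v)) hcard
      induction e with
      | _ x y => exact ⟨_, ht.cons (hshare x (by simp)) (hshare y (by simp))⟩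

variable {V : Type*} {G : SimpleGraph V}

open OrientedPath

lemma exists_reorientation {D : Multiset (OrientedPath G)} {t : Multiset (V × V)}
    (ht : t.map (fun x => s(x.1, x.2)) = D.map fun p => s(p.start, p.finish)) :
    ∃ D' : Multiset (OrientedPath G), edgesOf D' = edgesOf D ∧ D'.card = D.card ∧
      D'.map start = t.map Prod.fst ∧ D'.map finish = t.map Prod.snd := by
  induction D using Multiset.induction generalizing t with
  | empty => exact ⟨0, by simpa [eq_comm] using ht⟩
  | cons p D ih =>
    rw [Multiset.map_cons] at ht
    obtain ⟨⟨x, y⟩, hx, hxp⟩ :=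
      Multiset.mem_map.1 (ht ▸ Multiset.mem_cons_self s(p.start, p.finish) _)
    obtain ⟨t₀, rfl⟩ := Multiset.exists_cons_of_mem hx
    rw [Multiset.map_cons, hxp, Multiset.cons_inj_right] at ht
    obtain ⟨D', hE, hcard, hstart, hfinish⟩ := ih ht
    rcases Sym2.eq_iff.1 hxp with ⟨rfl, rfl⟩ | ⟨rfl, rfl⟩
    · exact ⟨p ::ₘ D', by simp [hE], by simp [hcard], by simp [hstart], by simp [hfinish]⟩
    · exact ⟨p.reverse ::ₘ D', by simp [hE], by simp [hcard], by simp [hstart], by simp [hfinish]⟩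

lemma bind_toMultiset_eq_endsOf (D : Multiset (OrientedPath G)) :
    (D.map fun p => s(p.start, p.finish)).bind Sym2.toMultiset = endsOf D := by
  have h := bind_toMultiset_map_mk (D.map fun p => (p.start, p.finish))
  simpa [endsOf, legs] using h

lemma card_endsOf (D : Multiset (OrientedPath G)) : (endsOf D).card = 2 * D.card := by
  simp [endsOf, legs, two_mul]

theorem exists_finset_injOn_start_finish [Fintype V] (H : SimpleGraph V) [DecidableRel H.Adj] :
    ∃ F : Finset (OrientedPath H), ∑ p ∈ F, p.edges = H.edgeFinset.val ∧
      Set.InjOn start (F : Set (OrientedPath H)) ∧ Set.InjOn finish (F : Set (OrientedPath H)) ∧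
      2 * F.card + numOdd H = 2 * Fintype.card V := by
  classical
  obtain ⟨D, hDE, hcount⟩ := exists_isBalanced H
  obtain ⟨t, ht, hfst, hsnd⟩ := exists_isInjectiveOrientation
    (s := D.map fun p => s(p.start, p.finish)) fun v => by
      rw [bind_toMultiset_eq_endsOf, ← hcount v]
      exact Nat.le_add_right _ _
  obtain ⟨D', hE, hcard, hstart, hfinish⟩ := exists_reorientation ht
  rw [← hstart] at hfst
  rw [← hfinish] at hsnd
  refine ⟨⟨D', hfst.of_map _⟩, hE.trans hDE,
    fun p hp q hq => Multiset.inj_on_of_nodup_map hfst p hp q hq,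
    fun p hp q hq => Multiset.inj_on_of_nodup_map hsnd p hp q hq, ?_⟩
  have hodd : numOdd H = ∑ v, degreeIn H.edgeFinset v % 2 := by
    simp only [numOdd, Finset.card_filter, degreeIn_edgeFinset]
    refine Finset.sum_congr rfl fun v _ => ?_
    split_ifs with hv
    · exact (Nat.odd_iff.1 hv).symm
    · exact (Nat.not_odd_iff.1 hv).symm
  rw [Finset.card_mk, hcard, ← card_endsOf,
    ← Multiset.sum_count_eq_card (s := Finset.univ) (by simp), hodd, ← Finset.sum_add_distrib,
    Finset.sum_congr rfl fun v _ => hcount v]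
  simp [mul_comm]

end Orientation

section PathNumber

variable {V : Type*} {G : SimpleGraph V}

lemma pathNumber_le_card_of_edgesOf {D : Multiset (OrientedPath G)} (hnodup : (edgesOf D).Nodup)
    (hcover : ∀ e ∈ G.edgeSet, e ∈ edgesOf D) : pathNumber G ≤ D.card := by
  classical
  let S : Finset G.Subgraph := (D.map fun p => p.walk.toSubgraph).toFinset
  have hS {P : G.Subgraph} : P ∈ S ↔ ∃ p ∈ D, p.walk.toSubgraph = P := by simp [S]
  have hdecomp : IsPathDecomposition G S := by
    refine ⟨fun P hP => ?_, fun P hP Q hQ hPQ => ?_, fun e he => ?_⟩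
    · obtain ⟨p, -, rfl⟩ := hS.1 hP
      exact ⟨_, _, p.walk, p.isPath, rfl⟩
    · obtain ⟨p, hp, rfl⟩ := hS.1 hP
      obtain ⟨q, hq, rfl⟩ := hS.1 hQ
      obtain ⟨D, rfl⟩ := Multiset.exists_cons_of_mem hp
      have hq' : q ∈ D := (Multiset.mem_cons.1 hq).resolve_left fun h => hPQ (h ▸ rfl)
      rw [edgesOf_cons, Multiset.nodup_add] at hnodup
      refine Set.disjoint_left.2 fun e hep heq => Multiset.disjoint_left.1 hnodup.2.2
        (p.walk.mem_edges_toSubgraph.1 hep) ?_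
      exact Multiset.mem_bind.2 ⟨q, hq', q.walk.mem_edges_toSubgraph.1 heq⟩
    · obtain ⟨p, hp, hep⟩ := Multiset.mem_bind.1 (hcover e he)
      exact ⟨_, hS.2 ⟨p, hp, rfl⟩, p.walk.mem_edges_toSubgraph.2 hep⟩
  calc pathNumber G ≤ S.card := pathNumber_le_card hdecomp
    _ ≤ (D.map fun p => p.walk.toSubgraph).card := Multiset.toFinset_card_le _
    _ = D.card := Multiset.card_map _ _

end PathNumber

section BoxProd

variable {U V : Type*} {G : SimpleGraph U} {H : SimpleGraph V}

open OrientedPath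

lemma nodup_bind_of_key {α β γ : Type*} {s : Multiset α} {f : α → Multiset β} (key : β → γ)
    {k : α → γ} (hk : k.Injective) (hs : s.Nodup) (hf : ∀ a ∈ s, (f a).Nodup)
    (hkey : ∀ a ∈ s, ∀ b ∈ f a, key b = k a) : (s.bind f).Nodup := by
  refine Multiset.nodup_bind.2 ⟨hf, Multiset.Nodup.pairwise (fun a ha a' ha' hne => ?_) hs⟩
  exact Multiset.disjoint_left.2 fun hb hb' =>
    hne (hk ((hkey a ha _ hb).symm.trans (hkey a' ha' _ hb')))

lemma map_fst_of_mem_layer {x : U} {E : Multiset (Sym2 V)} {f : Sym2 (U × V)}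
    (hf : f ∈ E.map (Sym2.map (Prod.mk x))) : f.map Prod.fst = Sym2.diag x := by
  obtain ⟨e, -, rfl⟩ := Multiset.mem_map.1 hf
  induction e with
  | _ a b => rfl

lemma exists_extension {u x : U} (h : G.Adj u x) {P : V → OrientedPath (G □ H)}
    (hstart : ∀ v, (P v).start = (x, v)) (hsupp : ∀ v, ∀ z ∈ (P v).support, z.1 ≠ u) :
    ∃ T : OrientedPath H → OrientedPath (G □ H), ∀ Q, (T Q).start = (u, Q.start) ∧
      (T Q).support = Q.support.map (Prod.mk u) ++ (P Q.finish).support ∧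
      (T Q).edges = Q.edges.map (Sym2.map (Prod.mk u)) +
        ({s((u, Q.finish), (x, Q.finish))} + (P Q.finish).edges) := by
  have hadj (Q : OrientedPath H) :
      (G □ H).Adj (Q.map (boxProdRight G H u)).finish (P Q.finish).start := by
    rw [hstart]
    exact boxProd_adj_left.2 h
  have hdisj (Q : OrientedPath H) :
      (Q.map (boxProdRight G H u)).support.Disjoint (P Q.finish).support := by
    intro z hz hzP
    rw [OrientedPath.support_map] at hz
    obtain ⟨v, -, rfl⟩ := List.mem_map.1 hz
    exact hsupp _ _ hzP rfl
  refine ⟨fun Q => join _ _ (hadj Q) (hdisj Q), fun Q => ⟨rfl, ?_, ?_⟩⟩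
  · rw [support_join, OrientedPath.support_map]
    rfl
  · rw [edges_join, OrientedPath.edges_map, hstart, add_left_comm, Multiset.singleton_add]
    rfl

variable [Fintype V]

/-- The edges of `w □ (V, E)` for a walk `w`: a copy of every edge of `w` over each vertex of `V`,
and a copy of `E` over each vertex of `w`. -/
def boxEdges {u u' : U} (w : G.Walk u u') (E : Multiset (Sym2 V)) : Multiset (Sym2 (U × V)) :=
  (w.edges : Multiset (Sym2 U)).bind
      (fun e => Finset.univ.val.map fun v : V => e.map fun x => (x, v)) +
    (w.support : Multiset U).bind fun x => E.map (Sym2.map (Prod.mk x))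

lemma boxEdges_nil (u : U) (E : Multiset (Sym2 V)) :
    boxEdges (.nil : G.Walk u u) E = E.map (Sym2.map (Prod.mk u)) := by
  simp [boxEdges]

lemma boxEdges_cons {u x u' : U} (h : G.Adj u x) (w : G.Walk x u') (E : Multiset (Sym2 V)) :
    boxEdges (.cons h w) E =
      ∑ v : V, {s((u, v), (x, v))} + E.map (Sym2.map (Prod.mk u)) + boxEdges w E := by
  have hsum : ∑ v : V, {s((u, v), (x, v))} = Finset.univ.val.map fun v : V => s((u, v), (x, v)) :=
    Multiset.bind_singleton _ _
  simp only [boxEdges, Walk.edges_cons, Walk.support_cons, ← Multiset.cons_coe,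
    Multiset.cons_bind, Sym2.map_mk, hsum]
  abel

lemma map_fst_of_mem_vertical {e : Sym2 U} {f : Sym2 (U × V)}
    (hf : f ∈ Finset.univ.val.map fun v : V => e.map fun x => (x, v)) : f.map Prod.fst = e := by
  obtain ⟨v, -, rfl⟩ := Multiset.mem_map.1 hf
  rw [Sym2.map_map]
  exact congrFun Sym2.map_id e

lemma nodup_boxEdges {u u' : U} {w : G.Walk u u'} (hw : w.IsPath) {E : Multiset (Sym2 V)}
    (hE : E.Nodup) : (boxEdges w E).Nodup := by
  refine Multiset.nodup_add.2 ⟨?_, ?_, Multiset.disjoint_left.2 fun {f} hf hf' => ?_⟩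
  · refine nodup_bind_of_key (Sym2.map Prod.fst) Function.injective_id hw.isTrail.edges_nodup
      (fun e _ => Finset.univ.nodup.map fun v v' h => ?_) fun e _ f hf => map_fst_of_mem_vertical hf
    induction e with
    | _ a b => simpa using congrArg (Sym2.map Prod.snd) h
  · exact nodup_bind_of_key (Sym2.map Prod.fst) Sym2.diag_injective hw.support_nodup
      (fun x _ => hE.map (Sym2.map.injective (Prod.mk_right_injective x)))
      fun x _ f hf => map_fst_of_mem_layer hf
  · obtain ⟨e, he, hf⟩ := Multiset.mem_bind.1 hf
    obtain ⟨x, -, hf'⟩ := Multiset.mem_bind.1 hf'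
    rw [← map_fst_of_mem_vertical hf, map_fst_of_mem_layer hf'] at he
    exact G.irrefl (w.adj_of_mem_edges he)

lemma mem_boxEdges_of_mem_edgeSet {u u' : U} {w : G.Walk u u'} {E : Multiset (Sym2 V)}
    (hsupp : ∀ x, x ∈ w.support) (hedges : ∀ e ∈ G.edgeSet, e ∈ w.edges)
    (hE : ∀ e ∈ H.edgeSet, e ∈ E) {f : Sym2 (U × V)} (hf : f ∈ (G □ H).edgeSet) :
    f ∈ boxEdges w E := by
  induction f with
  | _ z z' =>
    obtain ⟨x, v⟩ := z
    obtain ⟨x', v'⟩ := z'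
    obtain ⟨hadj : G.Adj x x', rfl : v = v'⟩ | ⟨hadj : H.Adj v v', rfl : x = x'⟩ := boxProd_adj.1 hf
    · exact Multiset.mem_add.2 (.inl (Multiset.mem_bind.2
        ⟨_, hedges s(x, x') hadj, Multiset.mem_map.2 ⟨v, Finset.mem_univ _, rfl⟩⟩))
    · exact Multiset.mem_add.2 (.inr (Multiset.mem_bind.2
        ⟨_, hsupp x, Multiset.mem_map.2 ⟨s(v, v'), hE _ hadj, rfl⟩⟩))

/-- The paths `T Q`, for `Q ∈ F`, and the paths `R` decompose the product of the walk `w` with the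
edges of `F`. The path `T Q` starts at the copy of `Q.start` over the first vertex of `w`, where it
can be entered from a layer added in front. -/
structure IsTower {u u' : U} (w : G.Walk u u') (F : Finset (OrientedPath H))
    (T : OrientedPath H → OrientedPath (G □ H)) (R : Multiset (OrientedPath (G □ H))) : Prop where
  start_eq (Q : OrientedPath H) : (T Q).start = (u, Q.start)
  fst_mem_support {Q : OrientedPath H} {z : U × V} : z ∈ (T Q).support → z.1 ∈ w.support
  edges_eq : edgesOf R + ∑ Q ∈ F, (T Q).edges = boxEdges w (∑ Q ∈ F, Q.edges)
  card_eq : R.card = w.length * (Fintype.card V - F.card)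

lemma isTower_nil (u : U) (F : Finset (OrientedPath H)) :
    IsTower (.nil : G.Walk u u) F (map (boxProdRight G H u)) 0 where
  start_eq Q := rfl
  fst_mem_support hz := by
    rw [OrientedPath.support_map] at hz
    obtain ⟨v, -, rfl⟩ := List.mem_map.1 hz
    exact List.mem_singleton_self u
  edges_eq := by
    simp only [OrientedPath.edges_map, boxEdges_nil, edgesOf_zero, zero_add]
    exact (map_sum (Multiset.mapAddMonoidHom (Sym2.map (Prod.mk u))) edges F).symm
  card_eq := by simp

lemma IsTower.exists_starting_at {u u' : U} {w : G.Walk u u'} {F : Finset (OrientedPath H)}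
    {T : OrientedPath H → OrientedPath (G □ H)} {R : Multiset (OrientedPath (G □ H))}
    (hT : IsTower w F T R) (hF : Set.InjOn start (F : Set (OrientedPath H))) :
    ∃ P : V → OrientedPath (G □ H), (∀ v, (P v).start = (u, v)) ∧
      (∀ v, ∀ z ∈ (P v).support, z.1 ∈ w.support) ∧
      ∑ v, (P v).edges = ∑ Q ∈ F, (T Q).edges := by
  classical
  let P (v : V) : OrientedPath (G □ H) :=
    if h : ∃ Q ∈ F, Q.start = v then T h.choose else single _ (u, v)
  have hP {Q : OrientedPath H} (hQ : Q ∈ F) : P Q.start = T Q := by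
    have h : ∃ Q' ∈ F, Q'.start = Q.start := ⟨Q, hQ, rfl⟩
    simp only [P, dif_pos h, hF h.choose_spec.1 hQ h.choose_spec.2]
  have hP' {v : V} (hv : v ∉ F.image start) : P v = single _ (u, v) :=
    dif_neg fun h => hv (Finset.mem_image.2 h)
  refine ⟨P, fun v => ?_, fun v z hz => ?_, ?_⟩
  · by_cases hv : v ∈ F.image start
    · obtain ⟨Q, hQ, rfl⟩ := Finset.mem_image.1 hv
      rw [hP hQ, hT.start_eq]
    · rw [hP' hv, single_start]
  · by_cases hv : v ∈ F.image start
    · obtain ⟨Q, hQ, rfl⟩ := Finset.mem_image.1 hv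
      exact hT.fst_mem_support (hP hQ ▸ hz)
    · rw [hP' hv, support_single, List.mem_singleton] at hz
      exact hz ▸ w.start_mem_support
  · calc ∑ v, (P v).edges = ∑ v ∈ F.image start, (P v).edges :=
          (Finset.sum_subset (Finset.subset_univ _) fun v _ hv => by rw [hP' hv, edges_single]).symm
      _ = ∑ Q ∈ F, (P Q.start).edges := Finset.sum_image hF
      _ = ∑ Q ∈ F, (T Q).edges := Finset.sum_congr rfl fun Q hQ => by rw [hP hQ]

lemma IsTower.exists_cons {u x u' : U} (h : G.Adj u x) {w : G.Walk x u'} (hu : u ∉ w.support)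
    {F : Finset (OrientedPath H)} (hstart : Set.InjOn start (F : Set (OrientedPath H)))
    (hfinish : Set.InjOn finish (F : Set (OrientedPath H)))
    {T : OrientedPath H → OrientedPath (G □ H)} {R : Multiset (OrientedPath (G □ H))}
    (hT : IsTower w F T R) : ∃ T' R', IsTower (.cons h w) F T' R' := by
  classical
  obtain ⟨P, hPstart, hPsupp, hPedges⟩ := hT.exists_starting_at hstart
  obtain ⟨T', hT'⟩ := exists_extension h hPstart
    fun v z hz => ne_of_mem_of_not_mem (hPsupp v z hz) hu
  -- The edges into the new layer are shared out: the edge over `v` goes to the copy of the path of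
  -- `F` that finishes at `v`, and to a path of its own if there is none.
  refine ⟨T', R + (F.image finish)ᶜ.val.map fun v => T' (single H v), fun Q => (hT' Q).1,
    fun {Q z} hz => ?_, ?_, ?_⟩
  · rw [(hT' Q).2.1, List.mem_append] at hz
    rw [Walk.support_cons, List.mem_cons]
    rcases hz with hz | hz
    · obtain ⟨v, -, rfl⟩ := List.mem_map.1 hz
      exact .inl rfl
    · exact .inr (hPsupp _ _ hz)
  · let up (v : V) : Multiset (Sym2 (U × V)) := {s((u, v), (x, v))} + (P v).edges
    have hnew : edgesOf ((F.image finish)ᶜ.val.map fun v => T' (single H v)) =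
        ∑ v ∈ (F.image finish)ᶜ, up v := by
      rw [edgesOf, Multiset.bind_map]
      refine Finset.sum_congr rfl fun v _ => ?_
      rw [(hT' _).2.2, edges_single, Multiset.map_zero, zero_add, single_finish]
    have hold : ∑ Q ∈ F, (T' Q).edges =
        (∑ Q ∈ F, Q.edges).map (Sym2.map (Prod.mk u)) + ∑ v ∈ F.image finish, up v := by
      rw [Finset.sum_image hfinish, Finset.sum_congr rfl fun Q _ => (hT' Q).2.2,
        Finset.sum_add_distrib]
      congr 1
      exact (map_sum (Multiset.mapAddMonoidHom (Sym2.map (Prod.mk u))) edges F).symm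
    calc edgesOf (R + (F.image finish)ᶜ.val.map fun v => T' (single H v)) + ∑ Q ∈ F, (T' Q).edges
        = edgesOf R + (∑ v ∈ (F.image finish)ᶜ, up v + ∑ v ∈ F.image finish, up v) +
            (∑ Q ∈ F, Q.edges).map (Sym2.map (Prod.mk u)) := by
          rw [edgesOf_add, hnew, hold]
          abel
      _ = boxEdges (.cons h w) (∑ Q ∈ F, Q.edges) := by
          rw [Finset.sum_compl_add_sum, Finset.sum_add_distrib, hPedges, boxEdges_cons,
            ← hT.edges_eq]
          abel
  · rw [Multiset.card_add, Multiset.card_map, hT.card_eq, Finset.card_val, Finset.card_compl,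
      Finset.card_image_of_injOn hfinish, Walk.length_cons, add_one_mul]

lemma exists_isTower {u u' : U} {w : G.Walk u u'} (hw : w.IsPath) {F : Finset (OrientedPath H)}
    (hstart : Set.InjOn start (F : Set (OrientedPath H)))
    (hfinish : Set.InjOn finish (F : Set (OrientedPath H))) : ∃ T R, IsTower w F T R := by
  induction w with
  | nil => exact ⟨_, _, isTower_nil _ F⟩
  | cons h w ih =>
    obtain ⟨hw, hu⟩ := (Walk.cons_isPath_iff h w).1 hw
    obtain ⟨T, R, hT⟩ := ih hw
    exact hT.exists_cons h hu hstart hfinish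

theorem pathNumber_boxProd_le {u u' : U} {w : G.Walk u u'} (hw : w.IsPath)
    (hsupp : ∀ x, x ∈ w.support) (hedges : ∀ e ∈ G.edgeSet, e ∈ w.edges)
    {F : Finset (OrientedPath H)} (hFnodup : (∑ Q ∈ F, Q.edges).Nodup)
    (hF : ∀ e ∈ H.edgeSet, e ∈ ∑ Q ∈ F, Q.edges)
    (hstart : Set.InjOn start (F : Set (OrientedPath H)))
    (hfinish : Set.InjOn finish (F : Set (OrientedPath H))) :
    pathNumber (G □ H) ≤ w.length * (Fintype.card V - F.card) + F.card := by
  obtain ⟨T, R, hT⟩ := exists_isTower hw hstart hfinish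
  have hE : edgesOf (R + F.val.map T) = boxEdges w (∑ Q ∈ F, Q.edges) := by
    rw [edgesOf_add, ← hT.edges_eq, edgesOf, edgesOf, Multiset.bind_map]
    rfl
  calc pathNumber (G □ H) ≤ (R + F.val.map T).card :=
        pathNumber_le_card_of_edgesOf (hE ▸ nodup_boxEdges hw hFnodup)
          fun e he => hE ▸ mem_boxEdges_of_mem_edgeSet hsupp hedges hF he
    _ = w.length * (Fintype.card V - F.card) + F.card := by
        rw [Multiset.card_add, Multiset.card_map, hT.card_eq, Finset.card_val]

end BoxProd

section PathGraph

lemma exists_eq_of_mem_edgeSet_pathGraph {k : ℕ} {e : Sym2 (Fin (k + 1))}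
    (he : e ∈ (pathGraph (k + 1)).edgeSet) : ∃ i : Fin k, e = s(i.castSucc, i.succ) := by
  induction e with
  | _ a b =>
    have hadj : (pathGraph (k + 1)).Adj a b := he
    rcases pathGraph_adj.1 hadj with h | h
    · exact ⟨⟨a, by omega⟩, congrArg (s(a, ·)) (Fin.ext h.symm)⟩
    · exact ⟨⟨b, by omega⟩, (congrArg (s(·, b)) (Fin.ext h.symm)).trans Sym2.eq_swap⟩

lemma exists_isPath_pathGraph (k : ℕ) :
    ∃ w : (pathGraph (k + 1)).Walk 0 (Fin.last k), w.IsPath ∧ w.length = k ∧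
      (∀ x, x ∈ w.support) ∧ ∀ e ∈ (pathGraph (k + 1)).edgeSet, e ∈ w.edges := by
  induction k with
  | zero =>
    refine ⟨.nil, .nil, rfl, fun x => List.mem_singleton.2 (Fin.fin_one_eq_zero x), fun e he => ?_⟩
    exact (exists_eq_of_mem_edgeSet_pathGraph he).choose.elim0
  | succ k ih =>
    obtain ⟨w, hw, hlength, hsupp, hedges⟩ := ih
    let f : pathGraph (k + 1) →g pathGraph (k + 2) := ⟨Fin.succ, by simp [pathGraph_adj]⟩
    have h : (pathGraph (k + 2)).Adj 0 (f 0) := pathGraph_adj.2 (.inl rfl)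
    refine ⟨.cons h (w.map f), (hw.map (Fin.succ_injective _)).cons ?_, ?_, fun x => ?_,
      fun e he => ?_⟩
    · rw [Walk.support_map]
      simp [f]
    · rw [Walk.length_cons, Walk.length_map, hlength]
    · cases x using Fin.cases with
      | zero => exact List.mem_cons_self
      | succ x =>
        rw [Walk.support_cons, Walk.support_map]
        exact List.mem_cons_of_mem _ (List.mem_map_of_mem (hsupp x))
    · obtain ⟨i, rfl⟩ := exists_eq_of_mem_edgeSet_pathGraph he
      rw [Walk.edges_cons, Walk.edges_map]
      cases i using Fin.cases with
      | zero => exact List.mem_cons_self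
      | succ i =>
        exact List.mem_cons_of_mem _ (List.mem_map_of_mem (hedges s(i.castSucc, i.succ)
          (pathGraph_adj.2 (.inl rfl))))

variable {V : Type*} [Fintype V]

lemma numOdd_add_numEven (H : SimpleGraph V) [DecidableRel H.Adj] :
    numOdd H + numEven H = Fintype.card V := by
  simp only [numOdd, numEven, ← Nat.not_odd_iff_even]
  exact Finset.card_filter_add_card_filter_not _

theorem two_mul_pathNumber_boxProd_pathGraph_le (H : SimpleGraph V) [DecidableRel H.Adj] (k : ℕ) :
    2 * pathNumber (pathGraph (k + 1) □ H) ≤ (k + 1) * numOdd H + 2 * numEven H := by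
  obtain ⟨F, hF, hstart, hfinish, hcard⟩ := exists_finset_injOn_start_finish H
  obtain ⟨w, hw, hlength, hsupp, hedges⟩ := exists_isPath_pathGraph k
  have hp := pathNumber_boxProd_le hw hsupp hedges (hF ▸ H.edgeFinset.nodup)
    (fun e he => hF ▸ mem_edgeFinset.2 he) hstart hfinish
  have hV := numOdd_add_numEven H
  have hodd : numOdd H = 2 * (Fintype.card V - F.card) := by omega
  rw [hlength] at hp
  have : (k + 1) * numOdd H = 2 * (k * (Fintype.card V - F.card)) + numOdd H := by
    rw [hodd]
    ring
  omega

end PathGraph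

end GallaiPath

theorem theorem3p1_general {V : Type*} [Fintype V] (H : SimpleGraph V) [DecidableRel H.Adj]
    (m : ℕ) (hm : 1 ≤ m) :
    (GallaiPath.pathNumber (SimpleGraph.boxProd (SimpleGraph.pathGraph m) H) : ℚ) ≤
        (m : ℚ) * (GallaiPath.numOdd H : ℚ) / 2 + (GallaiPath.numEven H : ℚ) ∧
      (2 ≤ m → (GallaiPath.pathNumber (SimpleGraph.boxProd (SimpleGraph.pathGraph m) H) : ℚ) ≤
        (Fintype.card (Fin m × V) : ℚ) / 2) := by
  obtain ⟨k, rfl⟩ := Nat.exists_eq_add_of_le' hm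
  have hp := GallaiPath.two_mul_pathNumber_boxProd_pathGraph_le H k
  refine ⟨?_, fun hk => ?_⟩
  · qify at hp
    push_cast
    linarith
  · have hcard : 2 * GallaiPath.pathNumber (SimpleGraph.boxProd (SimpleGraph.pathGraph (k + 1)) H) ≤
        Fintype.card (Fin (k + 1) × V) :=
      calc _ ≤ (k + 1) * GallaiPath.numOdd H + (k + 1) * GallaiPath.numEven H :=
            hp.trans (by gcongr)
        _ = Fintype.card (Fin (k + 1) × V) := by
            rw [← mul_add, GallaiPath.numOdd_add_numEven, Fintype.card_prod, Fintype.card_fin]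
    qify at hcard
    linarith

theorem theorem3p1 {V : Type*} [Fintype V] (H : SimpleGraph V) [DecidableRel H.Adj]
    (hH : H.Connected) (m : ℕ) (hm : 2 ≤ m) :
    (GallaiPath.pathNumber (SimpleGraph.boxProd (SimpleGraph.pathGraph m) H) : ℚ) ≤
        (m : ℚ) * (GallaiPath.numOdd H : ℚ) / 2 + (GallaiPath.numEven H : ℚ) ∧
      (GallaiPath.pathNumber (SimpleGraph.boxProd (SimpleGraph.pathGraph m) H) : ℚ) ≤
        (Fintype.card (Fin m × V) : ℚ) / 2 := by
  exact (theorem3p1_general H m (one_le_two.trans hm)).imp_right fun h => h hm
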